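/- Let $H$ be a complex Hilbert space, let $\mathcal K(H)$ be the compact operators on $H$, and let $U_c(H)=\{u \text{ unitary on } H : u-1\in\mathcal K(H)\}$. Let $P$ be an orthogonal projection on $H$ (of arbitrary, in particular possibly infinite, rank and corank) and let $\mathcal O_P=\{uPu^* : u\in U_c(H)\}$. For $b\in\mathcal O_P$ and a tangent vector $x$ of $\mathcal O_P$ at $b$, that is, $x=yb-by$ for some compact anti-hermitian $y$, put $$\|x\|_b=\inf\{\|y\| : y\in\mathcal K(H),\ y^*=-y,\ yb-by=x\},$$ and let the length of a continuous, piecewise $C^1$ (in operator norm) curve $\gamma:[a,b]\to\mathcal O_P$ be $L(\gamma)=\int_a^b\|\dot\gamma(t)\|_{\gamma(t)}\,dt$. **Theorem 6.1.** Let $p_0,p_1\in\mathcal O_P$. Then there is a compact operator $z$ on $H$ with $z^*=-z$, $\|z\|\le\pi/2$ and $p_0zp_0=(1-p_0)z(1-p_0)=0$ (that is, $z$ is $p_0$-co-diagonal), such that $$p_1=e^{z}p_0e^{-z},$$ and the curve $\gamma(t)=e^{tz}p_0e^{-tz}$, $t\in[0,1]$, is a minimal geodesic joining $p_0$ to $p_1$: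 it is a piecewise $C^1$ curve in $\mathcal O_P$ of finite length, and $L(\gamma)\le L(\sigma)$ for every continuous, piecewise $C^1$ curve $\sigma:[c,d]\to\mathcal O_P$, $c<d$, from $p_0$ to $p_1$. Moreover, if $p_0\ne p_1$ then $\dot\gamma(t)\neq 0$ for all $t\in[0,1]$. -/

import Mathlib

open Real Set
open scoped ENNReal

section Orbit

variable {H : Type*} [NormedAddCommGroup H] [InnerProductSpace ℂ H] [CompleteSpace H]

/-- The unitary Fredholm group: unitary operators `u` such that `u - 1` is compact. -/
def fredholmUnitary (H : Type*) [NormedAddCommGroup H] [InnerProductSpace ℂ H]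
    [CompleteSpace H] : Set (H →L[ℂ] H) :=
  {u | u ∈ unitary (H →L[ℂ] H) ∧ IsCompactOperator (u - 1 : H →L[ℂ] H)}

/-- The orbit `{u A u* : u in the unitary Fredholm group}` of an operator `A`. -/
def fredholmOrbit (A : H →L[ℂ] H) : Set (H →L[ℂ] H) :=
  {b | ∃ u ∈ fredholmUnitary H, b = u * A * star u}

/-- `x` is `p` co-diagonal: both diagonal blocks of `x` with respect to `p` vanish. -/
def IsCodiagonal (p x : H →L[ℂ] H) : Prop :=
  p * x * p = 0 ∧ (1 - p) * x * (1 - p) = 0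

/-- The quotient Finsler norm of a tangent vector `x` at the point `b` of an orbit: the infimum
of the operator norms of the compact anti-hermitian liftings `y` of `x`, i.e. those with
`y b - b y = x`. It is `⊤` when `x` has no lifting, that is, when `x` is not tangent at `b`. -/
noncomputable def finslerNorm (b x : H →L[ℂ] H) : ℝ≥0∞ :=
  ⨅ y : {y : H →L[ℂ] H //
    IsCompactOperator y ∧ y ∈ skewAdjoint (H →L[ℂ] H) ∧ y * b - b * y = x}, ‖y.1‖ₑ

/-- The length `∫_a^b ‖γ'(t)‖_{γ(t)} dt` of a curve for the quotient Finsler norm. -/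
noncomputable def finslerLength (a b : ℝ) (γ : ℝ → H →L[ℂ] H) : ℝ≥0∞ :=
  ∫⁻ t in Icc a b, finslerNorm (γ t) (deriv γ t)

/-- `γ` is continuous and piecewise `C¹` on `[a, b]`: there is a finite partition of `[a, b]`
such that `γ` is `C¹` on each closed piece (continuity on `[a, b]` follows). -/
def IsPiecewiseC1 (a b : ℝ) (γ : ℝ → H →L[ℂ] H) : Prop :=
  ∃ (n : ℕ) (s : Fin (n + 1) → ℝ), StrictMono s ∧ s 0 = a ∧ s (Fin.last n) = b ∧
    ∀ i : Fin n, ContDiffOn ℝ 1 γ (Icc (s i.castSucc) (s i.succ))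

/-- `γ`, restricted to `[a, b]`, is a piecewise `C¹` curve in the orbit of `A` which starts at `x`
and ends at `y`. -/
structure IsOrbitCurve (A : H →L[ℂ] H) (a b : ℝ) (γ : ℝ → H →L[ℂ] H) (x y : H →L[ℂ] H) :
    Prop where
  lt : a < b
  source : γ a = x
  target : γ b = y
  mem_orbit : ∀ t ∈ Icc a b, γ t ∈ fredholmOrbit A
  piecewiseC1 : IsPiecewiseC1 a b γ

/-- `γ`, restricted to `[a, b]`, is a curve in the orbit of `A` from `x` to `y`, of finite length,
which is not longer than any other piecewise `C¹` curve in the orbit from `x` to `y`. -/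
structure IsMinimalCurve (A : H →L[ℂ] H) (a b : ℝ) (γ : ℝ → H →L[ℂ] H) (x y : H →L[ℂ] H) :
    Prop where
  isOrbitCurve : IsOrbitCurve A a b γ x y
  length_lt_top : finslerLength a b γ < ⊤
  length_le : ∀ (c d : ℝ) (σ : ℝ → H →L[ℂ] H), IsOrbitCurve A c d σ x y →
    finslerLength a b γ ≤ finslerLength c d σ

/-- The curve `t ↦ e^{tz} p e^{-tz}`. -/
noncomputable def orbitGeodesic (p z : H →L[ℂ] H) (t : ℝ) : H →L[ℂ] H :=
  NormedSpace.exp (t • z) * p * NormedSpace.exp (-(t • z))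

end Orbit

/-! Existence of `z`. Write p, q for the two projections. If ‖p - q‖ < 1, the unitary u = (2q -
1)(2p - 1) has a principal logarithm. Half of it is anti-hermitian of norm at most π/2. It
anticommutes with 2p - 1, hence is co-diagonal, and its exponential carries p to q. It is compact
because u - 1 = 2(q - p)(2p - 1) is. In general p - q is compact, so ‖p - q‖ = 1 can only come from
the finite-dimensional spaces ran p ∩ ker q and ran q ∩ ker p. Their dimensions agree
(`finrank_excessSpace_le`): a Fredholm index is zero because the conjugating unitary is a compact
perturbation of 1. A quarter turn exchanging these spaces reduces the problem to the first case, and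
the two exponents have product zero in either order (`exists_codiagonal_exponent`).

Minimality. Every lifting of a tangent vector has norm at least the operator norm of that vector, so
a lower bound for the operator-norm length suffices. For a fixed unit vector ξ, the angle arccos
‖σ(t)ξ‖ between ξ and the range of σ(t) grows no faster than that length (`arccos_norm_apply_le`).
Compactness makes `z` attain its norm on a unit vector ξ in the range of p with z²ξ = -‖z‖²ξ. For
this ξ the final angle is exactly ‖z‖, while the geodesic has length at most ‖z‖ since `z` lifts its
velocity at every time. -/

section

variable {H : Type*} [NormedAddCommGroup H] [InnerProductSpace ℂ H]

/-! ### Compact operators, exponentials and the orbit -/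

theorem IsCompactOperator.mul_left {K : H →L[ℂ] H} (hK : IsCompactOperator K) (A : H →L[ℂ] H) :
    IsCompactOperator (A * K : H →L[ℂ] H) :=
  hK.clm_comp A

theorem IsCompactOperator.mul_right {K : H →L[ℂ] H} (hK : IsCompactOperator K) (A : H →L[ℂ] H) :
    IsCompactOperator (K * A : H →L[ℂ] H) :=
  hK.comp_clm A

variable [CompleteSpace H]

theorem hasDerivAt_exp_smul (A : H →L[ℂ] H) (t : ℝ) :
    HasDerivAt (fun s : ℝ => NormedSpace.exp (s • A)) (NormedSpace.exp (t • A) * A) t :=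
  hasDerivAt_exp_smul_const A t

theorem hasDerivAt_exp_neg_smul (A : H →L[ℂ] H) (t : ℝ) :
    HasDerivAt (fun s : ℝ => NormedSpace.exp (-(s • A))) (-(NormedSpace.exp (-(t • A)) * A)) t := by
  simpa using hasDerivAt_exp_smul (-A) t

theorem exp_mul_exp_neg (A : H →L[ℂ] H) : NormedSpace.exp A * NormedSpace.exp (-A) = 1 := by
  let _ : NormedAlgebra ℚ (H →L[ℂ] H) := NormedAlgebra.restrictScalars ℚ ℝ _
  rw [← NormedSpace.exp_add_of_commute (Commute.neg_right (Commute.refl A))]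
  simp

theorem exp_neg_mul_exp (A : H →L[ℂ] H) : NormedSpace.exp (-A) * NormedSpace.exp A = 1 := by
  simpa using exp_mul_exp_neg (-A)

/-- The vector e^{-sA} f(s) has zero derivative, hence is constant. This evaluates e^A on a vector
from an explicit solution of f' = A f. -/
theorem exp_apply_eq_of_hasDerivAt {A : H →L[ℂ] H} {f : ℝ → H}
    (hf : ∀ t, HasDerivAt f (A (f t)) t) : NormedSpace.exp A (f 0) = f 1 := by
  have hg : ∀ t : ℝ, HasDerivAt (fun s : ℝ => NormedSpace.exp (-(s • A)) (f s)) 0 t := fun t => by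
    have h := (((ContinuousLinearMap.restrictScalarsL ℂ H H ℝ ℝ).hasFDerivAt.comp_hasDerivAt t
      (hasDerivAt_exp_neg_smul A t))).clm_apply (hf t)
    refine HasDerivAt.congr_deriv h ?_
    symm
    change (0 : H) = -(NormedSpace.exp (-(t • A)) (A (f t))) + NormedSpace.exp (-(t • A)) (A (f t))
    simp
  have h := is_const_of_deriv_eq_zero (fun t => (hg t).differentiableAt) (fun t => (hg t).deriv) 0 1
  have h2 : NormedSpace.exp A (NormedSpace.exp (-A) (f 1)) = f 1 := by
    simpa using congr($(exp_mul_exp_neg A) (f 1))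
  simp at h
  rw [h, h2]

/-- On the span of ξ and Aξ the flow of A is a rotation with angular speed ω. -/
theorem exp_apply_of_apply_apply_eq {A : H →L[ℂ] H} {ω : ℝ} (hω : ω ≠ 0) {ξ : H}
    (h : A (A ξ) = -(ω ^ 2) • ξ) :
    NormedSpace.exp A ξ = cos ω • ξ + (sin ω / ω) • A ξ := by
  have := exp_apply_eq_of_hasDerivAt (A := A)
    (f := fun t : ℝ => cos (t * ω) • ξ + (sin (t * ω) / ω) • A ξ) fun t => by
      have h1 : HasDerivAt (fun t : ℝ => t * ω) ω t := by simpa using (hasDerivAt_id t).mul_const ω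
      have := ((h1.cos).smul_const ξ).add (((h1.sin).div_const ω).smul_const (A ξ))
      refine HasDerivAt.congr_deriv this ?_
      have hA : ∀ (r : ℝ) (x : H), A (r • x) = r • A x := fun r x => A.map_smul_of_tower r x
      rw [map_add, hA, hA, h, smul_smul, add_comm]
      congr 2
      · field_simp
      · field_simp
  simpa using this

theorem exp_apply_of_apply_eq_zero {A : H →L[ℂ] H} {ξ : H} (h : A ξ = 0) :
    NormedSpace.exp A ξ = ξ :=
  exp_apply_eq_of_hasDerivAt (f := fun _ => ξ) fun t => by simpa [h] using hasDerivAt_const t ξ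

/-- The exponential series without its constant term is a norm limit of compact partial sums. -/
theorem IsCompactOperator.exp_sub_one {A : H →L[ℂ] H} (hA : IsCompactOperator A) :
    IsCompactOperator (NormedSpace.exp A - 1 : H →L[ℂ] H) := by
  have h := NormedSpace.exp_series_hasSum_exp' (𝕂 := ℂ) A
  rw [← hasSum_nat_add_iff' 1] at h
  have : ∑ i ∈ Finset.range 1, ((i.factorial : ℂ)⁻¹) • A ^ i = 1 := by simp
  rw [this] at h
  refine isCompactOperator_of_tendsto h (Filter.Eventually.of_forall fun s => ?_)
  refine (compactOperator (RingHom.id ℂ) H H).sum_mem fun i _ => Submodule.smul_mem _ _ ?_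
  exact (hA.mul_left (A ^ i) : _)

theorem mul_mem_fredholmUnitary {u v : H →L[ℂ] H} (hu : u ∈ fredholmUnitary H)
    (hv : v ∈ fredholmUnitary H) : u * v ∈ fredholmUnitary H := by
  refine ⟨mul_mem hu.1 hv.1, ?_⟩
  have : u * v - 1 = u * (v - 1) + (u - 1) := by noncomm_ring
  rw [this]
  exact (hv.2.mul_left u).add hu.2

theorem star_mem_fredholmUnitary {u : H →L[ℂ] H} (hu : u ∈ fredholmUnitary H) :
    star u ∈ fredholmUnitary H := by
  refine ⟨Unitary.star_mem hu.1, ?_⟩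
  have : star u - 1 = (-star u) * (u - 1) := by
    rw [neg_mul, mul_sub, Unitary.star_mul_self_of_mem hu.1]
    noncomm_ring
  rw [this]
  exact hu.2.mul_left _

theorem exp_mem_fredholmUnitary {z : H →L[ℂ] H} (hz : IsCompactOperator z)
    (hs : z ∈ skewAdjoint (H →L[ℂ] H)) : NormedSpace.exp z ∈ fredholmUnitary H := by
  let _ : NormedAlgebra ℚ (H →L[ℂ] H) := NormedAlgebra.restrictScalars ℚ ℝ _
  exact ⟨NormedSpace.exp_mem_unitary_of_mem_skewAdjoint hs, hz.exp_sub_one⟩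

theorem star_exp_of_mem_skewAdjoint {z : H →L[ℂ] H} (hs : z ∈ skewAdjoint (H →L[ℂ] H)) :
    star (NormedSpace.exp z) = NormedSpace.exp (-z) := by
  rw [NormedSpace.star_exp, skewAdjoint.mem_iff.1 hs]

theorem IsStarProjection.unitary_conj {p w : H →L[ℂ] H} (hp : IsStarProjection p)
    (hw : w ∈ unitary (H →L[ℂ] H)) : IsStarProjection (w * p * star w) := by
  refine ⟨?_, ?_⟩
  · have h1 := Unitary.star_mul_self_of_mem hw
    have h2 := hp.isIdempotentElem.eq
    calc w * p * star w * (w * p * star w) = w * p * (star w * w) * p * star w := by noncomm_ring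
      _ = w * (p * p) * star w := by rw [h1]; noncomm_ring
      _ = _ := by rw [h2]
  · rw [isSelfAdjoint_iff]
    simp [hp.isSelfAdjoint.star_eq, mul_assoc]

theorem isStarProjection_of_mem_fredholmOrbit {P p : H →L[ℂ] H} (hP : IsStarProjection P)
    (hp : p ∈ fredholmOrbit P) : IsStarProjection p := by
  obtain ⟨u, hu, rfl⟩ := hp
  exact hP.unitary_conj hu.1

theorem exists_conj_of_mem_fredholmOrbit {P p q : H →L[ℂ] H}
    (hp : p ∈ fredholmOrbit P) (hq : q ∈ fredholmOrbit P) :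
    ∃ w ∈ fredholmUnitary H, q = w * p * star w := by
  obtain ⟨u, hu, rfl⟩ := hp
  obtain ⟨v, hv, rfl⟩ := hq
  refine ⟨v * star u, mul_mem_fredholmUnitary hv (star_mem_fredholmUnitary hu), ?_⟩
  have h1 := Unitary.star_mul_self_of_mem hu.1
  calc v * P * star v = v * 1 * P * 1 * star v := by noncomm_ring
    _ = _ := by rw [← h1]; simp [mul_assoc]

theorem mul_mul_star_mem_fredholmOrbit {P p w : H →L[ℂ] H} (hp : p ∈ fredholmOrbit P)
    (hw : w ∈ fredholmUnitary H) : w * p * star w ∈ fredholmOrbit P := by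
  obtain ⟨u, hu, rfl⟩ := hp
  exact ⟨w * u, mul_mem_fredholmUnitary hw hu, by simp [mul_assoc]⟩

end

/-! ### The spaces ran p ∩ ker q and ran q ∩ ker p, and equality of their dimensions -/

section

variable {H : Type*} [NormedAddCommGroup H] [InnerProductSpace ℂ H]

/-- The eigenspace of `p - q` for the eigenvalue `1`. For projections `p` and `q` it is the
intersection of the range of `p` with the kernel of `q`. -/
def excessSpace (p q : H →L[ℂ] H) : Submodule ℂ H :=
  Module.End.eigenspace ((p - q : H →L[ℂ] H) : H →ₗ[ℂ] H) 1

variable [CompleteSpace H]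

theorem IsStarProjection.apply_apply {p : H →L[ℂ] H} (hp : IsStarProjection p) (ξ : H) :
    p (p ξ) = p ξ :=
  congr($(hp.isIdempotentElem.eq) ξ)

theorem IsStarProjection.inner_apply_left {p : H →L[ℂ] H} (hp : IsStarProjection p) (ξ η : H) :
    inner ℂ (p ξ) η = inner ℂ ξ (p η) := by
  rw [← ContinuousLinearMap.adjoint_inner_left, ← ContinuousLinearMap.star_eq_adjoint,
    hp.isSelfAdjoint.star_eq]

theorem IsStarProjection.inner_self_apply {p : H →L[ℂ] H} (hp : IsStarProjection p) (ξ : H) :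
    inner ℂ ξ (p ξ) = (‖p ξ‖ ^ 2 : ℝ) := by
  nth_rewrite 1 [← hp.apply_apply]
  rw [← hp.inner_apply_left, inner_self_eq_norm_sq_to_K]
  simp

theorem IsStarProjection.norm_sq_add_norm_sq {p : H →L[ℂ] H} (hp : IsStarProjection p) (ξ : H) :
    ‖p ξ‖ ^ 2 + ‖ξ - p ξ‖ ^ 2 = ‖ξ‖ ^ 2 := by
  have h : inner ℂ (p ξ) (ξ - p ξ) = 0 := by
    rw [hp.inner_apply_left, map_sub, hp.apply_apply, sub_self, inner_zero_right]
  have := norm_add_sq_eq_norm_sq_add_norm_sq_of_inner_eq_zero (𝕜 := ℂ) _ _ h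
  rw [add_sub_cancel] at this
  nlinarith [this]

/-- Pairing (p - q)ξ = ξ with ξ gives ‖pξ‖² - ‖qξ‖² = ‖ξ‖². As ‖pξ‖ ≤ ‖ξ‖, this forces qξ = 0 and
‖pξ‖ = ‖ξ‖. -/
theorem mem_excessSpace {p q : H →L[ℂ] H} (hp : IsStarProjection p) (hq : IsStarProjection q)
    {ξ : H} : ξ ∈ excessSpace p q ↔ p ξ = ξ ∧ q ξ = 0 := by
  rw [excessSpace, Module.End.mem_eigenspace_iff]
  refine ⟨fun h => ?_, fun ⟨h1, h2⟩ => by simp [h1, h2]⟩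
  replace h : p ξ - q ξ = ξ := by simpa using h
  have h1 := congr(inner ℂ ξ $h)
  rw [inner_sub_right, hp.inner_self_apply, hq.inner_self_apply, inner_self_eq_norm_sq_to_K] at h1
  replace h1 : ‖p ξ‖ ^ 2 - ‖q ξ‖ ^ 2 = ‖ξ‖ ^ 2 := by
    apply Complex.ofReal_injective
    simpa using h1
  have h2 := hp.norm_sq_add_norm_sq ξ
  have h3 : ‖q ξ‖ = 0 := by nlinarith [sq_nonneg ‖q ξ‖, sq_nonneg ‖ξ - p ξ‖]
  have h4 : ‖ξ - p ξ‖ = 0 := by nlinarith [sq_nonneg ‖q ξ‖, sq_nonneg ‖ξ - p ξ‖]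
  exact ⟨(sub_eq_zero.1 (norm_eq_zero.1 h4)).symm, norm_eq_zero.1 h3⟩

theorem finiteDimensional_excessSpace {p q : H →L[ℂ] H}
    (h : IsCompactOperator (p - q : H →L[ℂ] H)) : FiniteDimensional ℂ (excessSpace p q) :=
  ContinuousLinearMap.finite_dimensional_eigenspace h 1 one_ne_zero

/-- The Fredholm alternative: injectivity says that -1 is not an eigenvalue of the compact operator
T - 1, so -1 lies in its resolvent set. -/
theorem surjective_of_injective_of_isCompactOperator_sub_one {T : H →L[ℂ] H}
    (hT : IsCompactOperator (T - 1 : H →L[ℂ] H)) (hi : Function.Injective T) :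
    Function.Surjective T := by
  have h1 : ¬ Module.End.HasEigenvalue ((T - 1 : H →L[ℂ] H) : H →ₗ[ℂ] H) (-1) := fun h => by
    obtain ⟨x, hx⟩ := h.exists_hasEigenvector
    have h2 : T x - x = -x := by simpa using hx.apply_eq_smul
    exact hx.2 (hi (by simpa using h2))
  have h2 := (hT.hasEigenvalue_or_mem_resolventSet (neg_ne_zero.2 one_ne_zero)).resolve_left h1
  rw [spectrum.mem_resolventSet_iff, ← IsUnit.neg_iff,
    ContinuousLinearMap.isUnit_iff_bijective] at h2
  convert! h2.2
  ext x
  simp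

theorem isCompactOperator_sub_of_conj {p w : H →L[ℂ] H} (hw : w ∈ fredholmUnitary H) :
    IsCompactOperator (p - w * p * star w : H →L[ℂ] H) := by
  have : p - w * p * star w = -((w - 1) * (p * star w)) + (-p) * (star w - 1) := by noncomm_ring
  rw [this]
  exact (hw.2.mul_right _).neg.add ((star_mem_fredholmUnitary hw).2.mul_left _)

/-- The operator A = pwp + 1 - p is a compact perturbation of 1. Its kernel is sent by w into ran q
∩ ker p, and its range is orthogonal to ran p ∩ ker q. Were the latter space larger, a finite-rank
correction would make A injective but not surjective, against the Fredholm alternative. -/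
theorem finrank_excessSpace_le {p q w : H →L[ℂ] H} (hp : IsStarProjection p)
    (hw : w ∈ fredholmUnitary H) (hq : q = w * p * star w) :
    Module.finrank ℂ (excessSpace p q) ≤ Module.finrank ℂ (excessSpace q p) := by
  have hq' : IsStarProjection q := hq ▸ hp.unitary_conj hw.1
  have hpq : IsCompactOperator (p - q : H →L[ℂ] H) := hq ▸ isCompactOperator_sub_of_conj hw
  have hqp : IsCompactOperator (q - p : H →L[ℂ] H) := by
    rw [← neg_sub]; exact hpq.neg
  have := finiteDimensional_excessSpace hpq
  have := finiteDimensional_excessSpace hqp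
  by_contra! hlt
  obtain ⟨F, hF⟩ := (finrank_le_iff_exists_linearMap (R := ℂ)).1 hlt.le
  have hw1 (ξ : H) : star w (w ξ) = ξ := congr($(Unitary.star_mul_self_of_mem hw.1) ξ)
  have hqw (ξ : H) : q (w ξ) = w (p ξ) := by
    have : q (w ξ) = w (p (star w (w ξ))) := by rw [hq]; rfl
    rw [this, hw1]
  have hpw (η : H) : p (star w η) = star w (q η) := by
    have : star w (q η) = star w (w (p (star w η))) := by rw [hq]; rfl
    rw [this, hw1]
  let Fc : excessSpace q p →L[ℂ] excessSpace p q := F.toContinuousLinearMap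
  let A : H →L[ℂ] H := p * w * p + 1 - p
  let R : H →L[ℂ] excessSpace p q := Fc ∘L (excessSpace q p).orthogonalProjectionOnto ∘L w
  -- The correction embeds the kernel of A into ran p ∩ ker q, which is orthogonal to the range of
  -- A; hence T ξ = 0 makes both summands vanish.
  let T : H →L[ℂ] H := A + (excessSpace p q).subtypeL ∘L R
  have hA (ξ : H) : A ξ = p (w (p ξ)) + ξ - p ξ := rfl
  have hAperp (ξ : H) (η : excessSpace p q) : inner ℂ (A ξ) (η : H) = 0 := by
    have h := (mem_excessSpace hp hq').1 η.2
    have hwp (x : H) : inner ℂ (w x) (η : H) = inner ℂ x (star w η) := by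
      rw [ContinuousLinearMap.star_eq_adjoint, ContinuousLinearMap.adjoint_inner_right]
    rw [hA, inner_sub_left, inner_add_left, hp.inner_apply_left, hp.inner_apply_left, h.1, hwp,
      hp.inner_apply_left, hpw, h.2]
    simp
  have hT (ξ : H) : T ξ = A ξ + (R ξ : H) := rfl
  have hinj : Function.Injective T := by
    refine (injective_iff_map_eq_zero T).2 fun ξ hξ => ?_
    have h0 : R ξ = 0 := by
      have := hAperp ξ (R ξ)
      rw [hT] at hξ
      rw [eq_neg_of_add_eq_zero_left hξ] at this
      simpa using this
    have h1 : A ξ = 0 := by simpa [hT, h0] using hξ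
    have h2 : p ξ = ξ := by
      have := congr(p $h1)
      simp only [hA, map_sub, map_add, hp.apply_apply, map_zero] at this
      have h3 : p (w (p ξ)) = 0 := by simpa using this
      rw [hA, h3, zero_add, sub_eq_zero] at h1
      exact h1.symm
    have h3 : w ξ ∈ excessSpace q p := by
      refine (mem_excessSpace hq' hp).2 ⟨by rw [hqw, h2], ?_⟩
      simpa [hA, h2] using h1
    have h4 : (excessSpace q p).orthogonalProjectionOnto (w ξ) = 0 := hF (by rw [map_zero]; exact h0)
    rw [Submodule.orthogonalProjectionOnto_mem_subspace_eq_self (⟨w ξ, h3⟩ : excessSpace q p)] at h4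
    have h5 : w ξ = 0 := congrArg Subtype.val h4
    rw [← hw1 ξ, h5, map_zero]
  have hcomp : IsCompactOperator (T - 1 : H →L[ℂ] H) := by
    have : T - 1 = p * (w - 1) * p + (excessSpace p q).subtypeL ∘L R := by
      have := hp.isIdempotentElem.eq
      simp only [T, A, mul_sub, sub_mul, mul_one, this]
      abel
    rw [this]
    refine ((hw.2.mul_left p).mul_right p).add ?_
    have := FiniteDimensional.proper ℂ (excessSpace p q)
    have : IsCompactOperator R := isCompactOperator_of_locallyCompactSpace_dom R
    exact this.clm_comp (excessSpace p q).subtypeL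
  have hsurj := surjective_of_injective_of_isCompactOperator_sub_one hcomp hinj
  -- By the strict dimension inequality `F` is not onto; a vector orthogonal to its range is missed
  -- by T.
  have hrange : (LinearMap.range F)ᗮ ≠ ⊥ := fun h => by
    rw [Submodule.orthogonal_eq_bot_iff] at h
    have := LinearMap.finrank_range_add_finrank_ker F
    rw [h, finrank_top] at this
    omega
  obtain ⟨η, hη, hη0⟩ := Submodule.exists_mem_ne_zero_of_ne_bot hrange
  obtain ⟨ξ, hξ⟩ := hsurj η
  have h1 : inner ℂ (R ξ) η = 0 := Submodule.inner_right_of_mem_orthogonal (LinearMap.mem_range_self F _) hη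
  have h2 : inner ℂ (η : H) (η : H) = 0 := by
    nth_rewrite 1 [← hξ]
    rw [hT, inner_add_left, hAperp, zero_add]
    exact h1
  exact hη0 (by simpa using h2)

/-- Equal finite dimensions give an isometry between the two excess spaces; extended by zero, it is
a finite-rank partial isometry W with initial projection E₁ and final projection E₂. -/
theorem exists_partialIsometry_excessSpace {p q w : H →L[ℂ] H} (hp : IsStarProjection p)
    (hw : w ∈ fredholmUnitary H) (hq : q = w * p * star w) :
    ∃ E₁ E₂ W : H →L[ℂ] H, IsStarProjection E₁ ∧ IsStarProjection E₂ ∧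
      (∀ ξ, E₁ ξ ∈ excessSpace p q) ∧ (∀ ξ ∈ excessSpace p q, E₁ ξ = ξ) ∧
      (∀ ξ, E₂ ξ ∈ excessSpace q p) ∧ (∀ ξ ∈ excessSpace q p, E₂ ξ = ξ) ∧
      IsCompactOperator W ∧ star W * W = E₁ ∧ W * star W = E₂ ∧ W * E₁ = W ∧ E₂ * W = W := by
  have hpq : IsCompactOperator (p - q : H →L[ℂ] H) := hq ▸ isCompactOperator_sub_of_conj hw
  have hqp : IsCompactOperator (q - p : H →L[ℂ] H) := by
    rw [← neg_sub]; exact hpq.neg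
  have := finiteDimensional_excessSpace hpq
  have := finiteDimensional_excessSpace hqp
  have hfr : Module.finrank ℂ (excessSpace p q) = Module.finrank ℂ (excessSpace q p) := by
    refine le_antisymm (finrank_excessSpace_le hp hw hq)
      (finrank_excessSpace_le (hq ▸ hp.unitary_conj hw.1) (star_mem_fredholmUnitary hw) ?_)
    have h1 := Unitary.star_mul_self_of_mem hw.1
    calc p = 1 * p * 1 := by simp
      _ = _ := by rw [← h1, hq]; simp [mul_assoc]
  let φ : excessSpace p q ≃ₗᵢ[ℂ] excessSpace q p :=
    (stdOrthonormalBasis ℂ (excessSpace p q)).equiv (stdOrthonormalBasis ℂ (excessSpace q p))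
      (finCongr hfr)
  let N₁ := excessSpace p q
  let N₂ := excessSpace q p
  let W : H →L[ℂ] H :=
    N₂.subtypeL ∘L (φ : N₁ →L[ℂ] N₂) ∘L N₁.orthogonalProjectionOnto
  let V : H →L[ℂ] H :=
    N₁.subtypeL ∘L (φ.symm : N₂ →L[ℂ] N₁) ∘L N₂.orthogonalProjectionOnto
  have hWV : star W = V := by
    rw [ContinuousLinearMap.star_eq_adjoint]
    symm
    rw [ContinuousLinearMap.eq_adjoint_iff]
    intro x y
    change inner ℂ ((φ.symm (N₂.orthogonalProjectionOnto x) : N₁) : H) y =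
      inner ℂ x ((φ (N₁.orthogonalProjectionOnto y) : N₂) : H)
    rw [← Submodule.inner_orthogonalProjectionOnto_eq_of_mem_left,
      ← Submodule.inner_orthogonalProjectionOnto_eq_of_mem_right, ← φ.inner_map_map]
    simp [N₁, N₂]
  refine ⟨N₁.starProjection, N₂.starProjection, W, isStarProjection_starProjection,
    isStarProjection_starProjection, fun ξ => N₁.starProjection_apply_mem ξ,
    fun ξ h => Submodule.starProjection_eq_self_iff.2 h, fun ξ => N₂.starProjection_apply_mem ξ,
    fun ξ h => Submodule.starProjection_eq_self_iff.2 h, ?_, ?_, ?_, ?_, ?_⟩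
  · have := FiniteDimensional.proper ℂ N₁
    have : IsCompactOperator N₁.orthogonalProjectionOnto :=
      isCompactOperator_of_locallyCompactSpace_dom N₁.orthogonalProjectionOnto
    exact this.clm_comp (N₂.subtypeL ∘L (φ : N₁ →L[ℂ] N₂))
  · rw [hWV]
    ext ξ
    simp [V, W, N₁, N₂]
  · rw [hWV]
    ext ξ
    simp [V, W, N₁, N₂]
  · ext ξ
    have : N₁.orthogonalProjectionOnto (N₁.starProjection ξ) = N₁.orthogonalProjectionOnto ξ :=
      N₁.orthogonalProjectionOnto_mem_subspace_eq_self _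
    simp [W, this]
  · ext ξ
    simp [W, N₁, N₂]

end

/-! ### Projections at distance less than one: the logarithm of a product of symmetries -/

section

variable {H : Type*} [NormedAddCommGroup H] [InnerProductSpace ℂ H] [CompleteSpace H]

theorem IsStarProjection.two_mul_sub_one_mul_self {p : H →L[ℂ] H} (hp : IsStarProjection p) :
    (2 * p - 1) * (2 * p - 1) = 1 := by
  have h : (2 * p - 1) * (2 * p - 1) = 4 * (p * p) - 4 * p + 1 := by noncomm_ring
  rw [h, hp.isIdempotentElem.eq]
  noncomm_ring

theorem IsStarProjection.norm_sub_le_one {p q : H →L[ℂ] H} (hp : IsStarProjection p)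
    (hq : IsStarProjection q) : ‖p - q‖ ≤ 1 := by
  refine ContinuousLinearMap.opNorm_le_bound _ zero_le_one fun ξ => ?_
  have h1 : (p - q) ξ = p (ξ - q ξ) - (q ξ - p (q ξ)) := by simp
  have h2 : inner ℂ (p (ξ - q ξ)) (q ξ - p (q ξ)) = 0 := by
    rw [hp.inner_apply_left, map_sub, hp.apply_apply, sub_self, inner_zero_right]
  have h3 : ‖(p - q) ξ‖ ^ 2 = ‖p (ξ - q ξ)‖ ^ 2 + ‖q ξ - p (q ξ)‖ ^ 2 := by
    rw [h1, @norm_sub_sq ℂ, h2]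
    simp
  have h4 := hp.norm_sq_add_norm_sq (ξ - q ξ)
  have h5 := hp.norm_sq_add_norm_sq (q ξ)
  have h6 := hq.norm_sq_add_norm_sq ξ
  rw [one_mul]
  refine abs_le_of_sq_le_sq' ?_ (norm_nonneg _) |>.2
  nlinarith [sq_nonneg ‖ξ - q ξ - p (ξ - q ξ)‖, sq_nonneg ‖p (q ξ)‖]

/-- A norm equal to 1 would make 1 or -1 a spectral value of the compact self-adjoint operator p -
q, hence an eigenvalue; the eigenspaces are the two excess spaces. -/
theorem IsStarProjection.norm_sub_lt_one {p q : H →L[ℂ] H} (hp : IsStarProjection p)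
    (hq : IsStarProjection q) (hpq : IsCompactOperator (p - q : H →L[ℂ] H))
    (h1 : excessSpace p q = ⊥) (h2 : excessSpace q p = ⊥) : ‖p - q‖ < 1 := by
  refine lt_of_le_of_ne (hp.norm_sub_le_one hq) fun h => ?_
  have : Nontrivial (H →L[ℂ] H) := ⟨p - q, 0, fun h0 => by simp [h0] at h⟩
  have hsa : IsSelfAdjoint (p - q) := hp.isSelfAdjoint.sub hq.isSelfAdjoint
  rcases CStarAlgebra.norm_or_neg_norm_mem_spectrum hsa with hs | hs
  · rw [h, ← spectrum.algebraMap_mem_iff ℂ] at hs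
    have := (hpq.hasEigenvalue_iff_mem_spectrum (by simp)).2 hs
    apply this
    simpa [excessSpace] using h1
  · rw [h, ← spectrum.algebraMap_mem_iff ℂ] at hs
    obtain ⟨x, hx⟩ := ((hpq.hasEigenvalue_iff_mem_spectrum (by simp)).2 hs).exists_hasEigenvector
    refine hx.2 ?_
    rw [← Submodule.mem_bot ℂ, ← h2, excessSpace, Module.End.mem_eigenspace_iff]
    have := hx.apply_eq_smul
    simp only [ContinuousLinearMap.coe_coe, sub_apply, map_neg, map_one,
      neg_smul, one_smul] at this ⊢
    rw [← neg_sub, this, neg_neg]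

/-- The continuous functional calculus of a unitary `u` with `‖u - 1‖ < 2`, applied to the
principal branch of the logarithm. -/
theorem I_smul_argSelfAdjoint_eq {u : unitary (H →L[ℂ] H)}
    (hu : ‖(u - 1 : H →L[ℂ] H)‖ < 2) :
    Complex.I • (Unitary.argSelfAdjoint u : H →L[ℂ] H) =
      cfc (dslope Complex.log 1) (u : H →L[ℂ] H) * (u - 1) := by
  have hsp := (Unitary.spectrum_subset_slitPlane_iff_norm_lt_two u.2).2 hu
  have harg : ContinuousOn (fun x : ℂ => (x.arg : ℂ)) (spectrum ℂ (u : H →L[ℂ] H)) :=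
    Complex.continuous_ofReal.comp_continuousOn (Complex.continuousOn_arg.mono hsp)
  have hds : ContinuousOn (dslope Complex.log 1) (spectrum ℂ (u : H →L[ℂ] H)) := by
    have h1 : Complex.slitPlane ∈ nhds (1 : ℂ) :=
      Complex.isOpen_slitPlane.mem_nhds Complex.one_mem_slitPlane
    refine ContinuousOn.mono ((continuousOn_dslope h1).2 ⟨?_, ?_⟩) hsp
    · exact fun x hx => (continuousAt_clog hx).continuousWithinAt
    · exact Complex.differentiableAt_log Complex.one_mem_slitPlane
  rw [Unitary.argSelfAdjoint_coe, ← cfc_smul Complex.I _ (u : H →L[ℂ] H) harg]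
  have h1 : (u - 1 : H →L[ℂ] H) = cfc (fun x : ℂ => x - 1) (u : H →L[ℂ] H) := by
    rw [cfc_sub (fun x : ℂ => x) (fun _ => 1) (u : H →L[ℂ] H), cfc_id' ℂ (u : H →L[ℂ] H),
      cfc_const_one ℂ (u : H →L[ℂ] H)]
  rw [h1, ← cfc_mul _ _ (u : H →L[ℂ] H) hds (by fun_prop)]
  refine cfc_congr fun x hx => ?_
  -- On the unit circle log x = i arg x, and log x = (x - 1) · `dslope`. The factor u - 1 transfers
  -- compactness and vanishing from u - 1 to the logarithm.
  have hn : ‖x‖ = 1 := spectrum.norm_eq_one_of_unitary u.2 hx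
  have h2 := sub_smul_dslope Complex.log 1 x
  rw [smul_eq_mul, Complex.log_one, sub_zero] at h2
  rw [mul_comm, h2]
  exact Complex.ext (by simp [Complex.log_re, hn]) (by simp [Complex.log_im])

/-- Conjugation by e commutes with the functional calculus, and arg of a complex conjugate is -arg
off the negative axis. -/
theorem conj_argSelfAdjoint {u : unitary (H →L[ℂ] H)} (hu : ‖(u - 1 : H →L[ℂ] H)‖ < 2)
    {e : H →L[ℂ] H} (he : e ∈ unitary (H →L[ℂ] H))
    (hue : e * u * star e = star (u : H →L[ℂ] H)) :
    e * (Unitary.argSelfAdjoint u : H →L[ℂ] H) * star e =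
      -(Unitary.argSelfAdjoint u : H →L[ℂ] H) := by
  have hsp := (Unitary.spectrum_subset_slitPlane_iff_norm_lt_two u.2).2 hu
  have harg : ContinuousOn (fun x : ℂ => (x.arg : ℂ)) (spectrum ℂ (u : H →L[ℂ] H)) :=
    Complex.continuous_ofReal.comp_continuousOn (Complex.continuousOn_arg.mono hsp)
  have h1 := StarAlgHomClass.map_cfc (Unitary.conjStarAlgAut ℂ (H →L[ℂ] H) ⟨e, he⟩)
    (fun x : ℂ => (x.arg : ℂ)) (u : H →L[ℂ] H) harg
    (show Continuous fun x => e * x * star e by fun_prop) (by cfc_tac) (by cfc_tac)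
  simp only [Unitary.conjStarAlgAut_apply] at h1
  rw [Unitary.argSelfAdjoint_coe]
  refine h1.trans ?_
  have harg' : ContinuousOn (fun x : ℂ => (x.arg : ℂ)) (star '' spectrum ℂ (u : H →L[ℂ] H)) := by
    refine Complex.continuous_ofReal.comp_continuousOn (Complex.continuousOn_arg.mono ?_)
    rintro _ ⟨x, hx, rfl⟩
    simpa [Complex.mem_slitPlane_iff] using hsp hx
  rw [hue, ← cfc_comp_star (fun x : ℂ => (x.arg : ℂ)) (u : H →L[ℂ] H) harg', ← cfc_neg]
  refine cfc_congr fun x hx => ?_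
  have := Complex.slitPlane_arg_ne_pi (hsp hx)
  simp [Complex.arg_conj, this]

/-- With e = 2q - 1 and u = (2p - 1)e, take z to be half the logarithm of u. Since e u e = u*, also
e z e = -z, so z is co-diagonal and e^z e e^{-z} = e^{2z} e = 2p - 1. The last clause, that z
vanishes wherever p and q agree, serves to combine z with a rotation of the excess spaces. -/
theorem exists_codiagonal_of_norm_sub_lt_one {p q : H →L[ℂ] H} (hp : IsStarProjection p)
    (hq : IsStarProjection q) (hc : IsCompactOperator (p - q : H →L[ℂ] H)) (hlt : ‖p - q‖ < 1) :
    ∃ z : H →L[ℂ] H, IsCompactOperator z ∧ z ∈ skewAdjoint (H →L[ℂ] H) ∧ IsCodiagonal q z ∧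
      ‖z‖ ≤ π / 2 ∧ p = NormedSpace.exp z * q * NormedSpace.exp (-z) ∧
      ∀ A : H →L[ℂ] H, p * A = q * A → z * A = 0 := by
  let _ : NormedAlgebra ℚ (H →L[ℂ] H) := NormedAlgebra.restrictScalars ℚ ℝ _
  set e : H →L[ℂ] H := 2 * q - 1 with he
  have hee : e * e = 1 := hq.two_mul_sub_one_mul_self
  have hse : star e = e := by simp [he, hq.isSelfAdjoint.star_eq, two_mul]
  have hsp : star (2 * p - 1) = 2 * p - 1 := by simp [hp.isSelfAdjoint.star_eq, two_mul]
  have heu : e ∈ unitary (H →L[ℂ] H) := hq.two_mul_sub_one_mem_unitary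
  let u : unitary (H →L[ℂ] H) := ⟨(2 * p - 1) * e, mul_mem hp.two_mul_sub_one_mem_unitary heu⟩
  have hu1 : (u - 1 : H →L[ℂ] H) = (2 : ℂ) • ((p - q) * e) := by
    have h1 : (u - 1 : H →L[ℂ] H) = (2 * p - 1) * e - e * e := by rw [hee]
    rw [h1, he, two_smul]
    noncomm_ring
  have hu : ‖(u - 1 : H →L[ℂ] H)‖ < 2 := by
    rw [hu1, norm_smul, Complex.norm_two, CStarRing.norm_mul_mem_unitary _ heu]
    linarith
  have hcu : IsCompactOperator (u - 1 : H →L[ℂ] H) := by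
    rw [hu1]
    exact (hc.mul_right e).smul (2 : ℂ)
  set a : H →L[ℂ] H := (Unitary.argSelfAdjoint u : H →L[ℂ] H) with ha
  have hsa : star a = a := (Unitary.argSelfAdjoint u).2
  have hIa : Complex.I • a = cfc (dslope Complex.log 1) (u : H →L[ℂ] H) * (u - 1) :=
    I_smul_argSelfAdjoint_eq hu
  have hexp : NormedSpace.exp (Complex.I • a) = (2 * p - 1) * e := by
    have := congr(($(expUnitary_argSelfAdjoint hu) : H →L[ℂ] H))
    rwa [selfAdjoint.expUnitary_coe] at this
  have hconj : e * a * e = -a := by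
    have := conj_argSelfAdjoint hu heu (by
      simp only [u, hse, star_mul, hsp]
      rw [mul_assoc, mul_assoc, hee, mul_one])
    rwa [hse] at this
  set z : H →L[ℂ] H := (2⁻¹ : ℂ) • (Complex.I • a) with hz
  have hzz : z + z = Complex.I • a := by rw [hz, ← add_smul]; norm_num
  have hez : e * z * e = -z := by
    simp only [hz, mul_smul_comm, smul_mul_assoc, hconj, smul_neg]
  have hez' : e * z = -z * e := by
    rw [← hez, mul_assoc, hee, mul_one]
  have hqz : q * z + z * q = z := by
    have h : (2 : ℂ) • (q * z + z * q - z) = e * z + z * e := by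
      rw [he, two_smul]
      noncomm_ring
    rw [hez', neg_mul, neg_add_cancel, smul_eq_zero_iff_right two_ne_zero] at h
    exact sub_eq_zero.1 h
  have hqzq : q * z * q = 0 := by
    have h := congr(q * $hqz)
    rw [mul_add, ← mul_assoc, hq.isIdempotentElem.eq, ← mul_assoc] at h
    simpa using h
  refine ⟨z, ?_, ?_, ⟨hqzq, ?_⟩, ?_, ?_, fun A hA => ?_⟩
  · have : IsCompactOperator (Complex.I • a : H →L[ℂ] H) := by
      rw [hIa]
      exact hcu.mul_left _
    exact this.smul (2⁻¹ : ℂ)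
  · rw [skewAdjoint.mem_iff, hz]
    simp [hsa]
  · have : (1 - q) * z * (1 - q) = z - (q * z + z * q) + q * z * q := by noncomm_ring
    rw [this, hqz, hqzq]
    simp
  · have h1 : ‖a‖ ≤ π := Unitary.norm_argSelfAdjoint_le_pi u
    rw [hz, norm_smul, norm_smul]
    simp
    linarith
  · have h1 : NormedSpace.exp (-z) = e * NormedSpace.exp z * e := by
      have := NormedSpace.exp_units_conj (⟨e, e, hee, hee⟩ : (H →L[ℂ] H)ˣ) z
      simp only [Units.inv_mk] at this
      rw [← hez, this]
    have h2 : NormedSpace.exp z * e * NormedSpace.exp (-z) = 2 * p - 1 := by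
      calc _ = NormedSpace.exp z * (e * e) * NormedSpace.exp z * e := by
            rw [h1]; noncomm_ring
        _ = (NormedSpace.exp z * NormedSpace.exp z) * e := by rw [hee, mul_one]
        _ = _ := by
          rw [← NormedSpace.exp_add_of_commute (Commute.refl z), hzz, hexp, mul_assoc, hee, mul_one]
    have h3 : NormedSpace.exp z * e * NormedSpace.exp (-z) =
        2 * (NormedSpace.exp z * q * NormedSpace.exp (-z)) - 1 := by
      have := exp_mul_exp_neg z
      calc _ = 2 * (NormedSpace.exp z * q * NormedSpace.exp (-z))
          - NormedSpace.exp z * NormedSpace.exp (-z) := by rw [he]; noncomm_ring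
        _ = _ := by rw [this]
    have h4 : (2 : ℂ) • p = (2 : ℂ) • (NormedSpace.exp z * q * NormedSpace.exp (-z)) := by
      rw [h3] at h2
      simpa [two_smul, two_mul] using h2.symm
    exact smul_right_injective _ (two_ne_zero' ℂ) h4
  · have h1 : (u - 1 : H →L[ℂ] H) * A = 0 := by
      have h2 : e * A = (2 * p - 1) * A := by
        rw [he, sub_mul, sub_mul, mul_assoc, mul_assoc, hA]
      have h3 : (u - 1 : H →L[ℂ] H) * A = (2 * p - 1) * (e * A) - A := by
        simp only [u]
        noncomm_ring
      rw [h3, h2, ← mul_assoc, hp.two_mul_sub_one_mul_self, one_mul, sub_self]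
    rw [hz, smul_mul_assoc, hIa, mul_assoc, h1]
    simp

end

/-! ### The general exponent: a quarter turn on the excess spaces plus a logarithm -/

section

variable {H : Type*} [NormedAddCommGroup H] [InnerProductSpace ℂ H] [CompleteSpace H]

/-- Two projections which are conjugate under the unitary Fredholm group are joined by a compact
co-diagonal exponent of norm at most `π / 2`. -/
theorem exists_codiagonal_exponent {p q w : H →L[ℂ] H} (hp : IsStarProjection p)
    (hw : w ∈ fredholmUnitary H) (hq : q = w * p * star w) :
    ∃ z : H →L[ℂ] H, IsCompactOperator z ∧ z ∈ skewAdjoint (H →L[ℂ] H) ∧ IsCodiagonal p z ∧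
      ‖z‖ ≤ π / 2 ∧ q = NormedSpace.exp z * p * NormedSpace.exp (-z) := by
  let _ : NormedAlgebra ℚ (H →L[ℂ] H) := NormedAlgebra.restrictScalars ℚ ℝ _
  have hq' : IsStarProjection q := hq ▸ hp.unitary_conj hw.1
  obtain ⟨E₁, E₂, W, hE₁, hE₂, hE₁m, hE₁f, hE₂m, hE₂f, hWc, hWW, hWW', hWE, hEW⟩ :=
    exists_partialIsometry_excessSpace hp hw hq
  have hpE₁ : p * E₁ = E₁ := by ext ξ; exact ((mem_excessSpace hp hq').1 (hE₁m ξ)).1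
  have hqE₁ : q * E₁ = 0 := by ext ξ; exact ((mem_excessSpace hp hq').1 (hE₁m ξ)).2
  have hqE₂ : q * E₂ = E₂ := by ext ξ; exact ((mem_excessSpace hq' hp).1 (hE₂m ξ)).1
  have hpE₂ : p * E₂ = 0 := by ext ξ; exact ((mem_excessSpace hq' hp).1 (hE₂m ξ)).2
  have sp := hp.isSelfAdjoint.star_eq
  have sq := hq'.isSelfAdjoint.star_eq
  have s₁ := hE₁.isSelfAdjoint.star_eq
  have s₂ := hE₂.isSelfAdjoint.star_eq
  have i₁ := hE₁.isIdempotentElem.eq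
  have i₂ := hE₂.isIdempotentElem.eq
  have ip := hp.isIdempotentElem.eq
  have hE₁p : E₁ * p = E₁ := by simpa [sp, s₁] using congr(star $hpE₁)
  have hE₁q : E₁ * q = 0 := by simpa [sq, s₁] using congr(star $hqE₁)
  have hE₂q : E₂ * q = E₂ := by simpa [sq, s₂] using congr(star $hqE₂)
  have hE₂p : E₂ * p = 0 := by simpa [sp, s₂] using congr(star $hpE₂)
  have hE₁₂ : E₁ * E₂ = 0 := by rw [← hE₁p, mul_assoc, hpE₂, mul_zero]
  have hE₂₁ : E₂ * E₁ = 0 := by rw [← hE₂q, mul_assoc, hqE₁, mul_zero]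
  have hVE : star W * E₂ = star W := by simpa [s₂] using congr(star $hEW)
  have hEV : E₁ * star W = star W := by simpa [s₁] using congr(star $hWE)
  have hWE₂ : W * E₂ = 0 := by rw [← hWE, mul_assoc, hE₁₂, mul_zero]
  have hE₁W : E₁ * W = 0 := by rw [← hEW, ← mul_assoc, hE₁₂, zero_mul]
  have hVE₁ : star W * E₁ = 0 := by rw [← hVE, mul_assoc, hE₂₁, mul_zero]
  have hW2 : W * W = 0 := by
    nth_rewrite 2 [← hEW]
    rw [← mul_assoc, hWE₂, zero_mul]
  have hV2 : star W * star W = 0 := by simpa using congr(star $hW2)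
  have hpW : p * W = 0 := by rw [← hEW, ← mul_assoc, hpE₂, zero_mul]
  have hWp : W * p = W := by rw [← hWE, mul_assoc, hE₁p]
  have hpV : p * star W = star W := by rw [← hEV, ← mul_assoc, hpE₁]
  have hVp : star W * p = 0 := by rw [← hVE, mul_assoc, hE₂p, mul_zero]
  set E : H →L[ℂ] H := E₁ + E₂ with hE
  -- J is a complex structure on the sum of the two excess spaces (J² = -E) and zero on its
  -- complement.
  set J : H →L[ℂ] H := W - star W with hJ
  have hEE : IsStarProjection E := by
    refine ⟨?_, by rw [isSelfAdjoint_iff, hE, star_add, s₁, s₂]⟩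
    change E * E = E
    simp only [hE, mul_add, add_mul, i₁, i₂, hE₁₂, hE₂₁]
    simp
  have hJE : J * E = J := by
    simp only [hE, hJ, mul_add, sub_mul, hWE, hWE₂, hVE, hVE₁]; abel
  have hJs : star J = -J := by simp [hJ]
  have hJJ : J * J = -E := by
    simp only [hE, hJ, mul_sub, sub_mul, hW2, hV2, hWW, hWW']; abel
  have hJn : ‖J‖ ≤ 1 := by
    have h1 : ‖J‖ * ‖J‖ ≤ 1 := by
      rw [← CStarRing.norm_star_mul_self, hJs, neg_mul, hJJ, neg_neg]
      exact hEE.norm_le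
    nlinarith [norm_nonneg J]
  -- r is p with ran p ∩ ker q replaced by ran q ∩ ker p. It agrees with q on the range of E, so no
  -- excess remains between q and r.
  set r : H →L[ℂ] H := p - E₁ + E₂ with hr
  have hrr : IsStarProjection r := by
    refine ⟨?_, by rw [isSelfAdjoint_iff, hr, star_add, star_sub, s₁, s₂, sp]⟩
    change r * r = r
    simp only [hr, mul_add, add_mul, mul_sub, sub_mul, ip, i₁, i₂, hE₁₂, hE₂₁, hpE₁, hpE₂, hE₁p,
      hE₂p]
    abel
  have hrq : IsCompactOperator (q - r : H →L[ℂ] H) := by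
    have h1 : IsCompactOperator (p - q : H →L[ℂ] H) := hq ▸ isCompactOperator_sub_of_conj hw
    have : q - r = -(p - q) + (star W * W - W * star W) := by rw [hWW, hWW', hr]; abel
    rw [this]
    exact h1.neg.add ((hWc.mul_left _).sub (hWc.mul_right _))
  have hrapp (ξ : H) : r ξ = p ξ - E₁ ξ + E₂ ξ := rfl
  have hlt : ‖q - r‖ < 1 := by
    refine hq'.norm_sub_lt_one hrr hrq ?_ ?_
    · refine (Submodule.eq_bot_iff _).2 fun ξ hξ => ?_
      obtain ⟨h1, h2⟩ := (mem_excessSpace hq' hrr).1 hξ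
      have h3 : E₁ ξ = 0 := by rw [← h1]; exact congr($hE₁q ξ)
      have h4 : p ξ = 0 := by
        have h5 := congr(p $h2)
        have h6 : p (E₂ ξ) = 0 := congr($hpE₂ ξ)
        simpa [hrapp, h3, h6, hp.apply_apply] using h5
      have h5 : E₂ ξ = ξ := hE₂f ξ ((mem_excessSpace hq' hp).2 ⟨h1, h4⟩)
      simpa [hrapp, h3, h4, h5] using h2
    · refine (Submodule.eq_bot_iff _).2 fun ξ hξ => ?_
      obtain ⟨h1, h2⟩ := (mem_excessSpace hrr hq').1 hξ
      have h3 : E₂ ξ = 0 := by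
        have : E₂ (q ξ) = E₂ ξ := congr($hE₂q ξ)
        rw [← this, h2, map_zero]
      have h4 : p ξ = ξ := by
        have h5 : p ξ - E₁ ξ = ξ := by simpa [hrapp, h3] using h1
        have h6 : p (E₁ ξ) = E₁ ξ := congr($hpE₁ ξ)
        have h7 := congr(p $h5)
        rw [map_sub, hp.apply_apply, h6] at h7
        exact h7.symm.trans h5
      have h5 : E₁ ξ = ξ := hE₁f ξ ((mem_excessSpace hp hq').2 ⟨h4, h2⟩)
      simpa [hrapp, h3, h4, h5] using h1.symm
  obtain ⟨z₀, hz₀c, hz₀s, hz₀d, hz₀n, hz₀e, hz₀k⟩ :=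
    exists_codiagonal_of_norm_sub_lt_one hq' hrr hrq hlt
  have hs₀ := skewAdjoint.mem_iff.1 hz₀s
  have hzE₁ : z₀ * E₁ = 0 := hz₀k _ (by
    simp only [hr, add_mul, sub_mul, hqE₁, hpE₁, i₁, hE₂₁]; abel)
  have hzE₂ : z₀ * E₂ = 0 := hz₀k _ (by
    simp only [hr, add_mul, sub_mul, hqE₂, hpE₂, i₂, hE₁₂]; abel)
  have hE₁z : E₁ * z₀ = 0 := by simpa [hs₀, s₁] using congr(star $hzE₁)
  have hE₂z : E₂ * z₀ = 0 := by simpa [hs₀, s₂] using congr(star $hzE₂)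
  have hzE : z₀ * E = 0 := by rw [hE, mul_add, hzE₁, hzE₂, add_zero]
  have hzJ : z₀ * J = 0 := by
    have h1 : z₀ * W = 0 := by rw [← hEW, ← mul_assoc, hzE₂, zero_mul]
    have h2 : z₀ * star W = 0 := by rw [← hEV, ← mul_assoc, hzE₁, zero_mul]
    rw [hJ, mul_sub, h1, h2, sub_zero]
  have hJz : J * z₀ = 0 := by
    have h1 : W * z₀ = 0 := by rw [← hWE, mul_assoc, hE₁z, mul_zero]
    have h2 : star W * z₀ = 0 := by rw [← hVE, mul_assoc, hE₂z, mul_zero]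
    rw [hJ, sub_mul, h1, h2, sub_zero]
  -- The factor π/2 makes e^y equal to J on the range of E, which exchanges the excess spaces and
  -- carries p to r.
  set y : H →L[ℂ] H := (π / 2) • J with hy
  have hys : star y = -y := by rw [hy, star_smul, hJs, smul_neg]; simp
  have hzy : z₀ * y = 0 := by rw [hy, mul_smul_comm, hzJ, smul_zero]
  have hyz : y * z₀ = 0 := by rw [hy, smul_mul_assoc, hJz, smul_zero]
  have hyE : y * E = y := by rw [hy, smul_mul_assoc, hJE]
  have hexpy : NormedSpace.exp y = 1 - E + J := by
    ext ξ
    have h1 : ξ = (ξ - E ξ) + E ξ := by simp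
    have h2 : y (ξ - E ξ) = 0 := by
      have : y (E ξ) = y ξ := congr($hyE ξ)
      rw [map_sub, this, sub_self]
    have h3 : y (y (E ξ)) = -((π / 2) ^ 2) • E ξ := by
      have : y * y * E = -((π / 2) ^ 2) • E := by
        rw [hy, smul_mul_smul_comm, hJJ, smul_mul_assoc, neg_mul, hEE.isIdempotentElem.eq,
          smul_neg, neg_smul, pow_two]
      exact congr($this ξ)
    have h4 : NormedSpace.exp y (E ξ) = J ξ := by
      rw [exp_apply_of_apply_apply_eq (by positivity) h3, cos_pi_div_two, sin_pi_div_two, zero_smul,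
        zero_add]
      have h5 : y (E ξ) = (π / 2) • J ξ := congr($hyE ξ)
      rw [h5, smul_smul, one_div_mul_cancel (by positivity), one_smul]
    nth_rewrite 1 [h1]
    rw [map_add, exp_apply_of_apply_eq_zero h2, h4]
    simp
  have hexpy' : NormedSpace.exp (-y) = 1 - E - J := by
    rw [← hys, ← NormedSpace.star_exp, hexpy, star_add, star_sub, star_one,
      hEE.isSelfAdjoint.star_eq, hJs, sub_eq_add_neg _ J]
  have hconj : NormedSpace.exp y * p * NormedSpace.exp (-y) = r := by
    rw [hexpy, hexpy']
    have h1 : (1 - E + J) * p = p - E₁ + W := by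
      simp only [hE, hJ, add_mul, sub_mul, one_mul, hE₁p, hE₂p, hWp, hVp]; abel
    rw [h1]
    simp only [hE, hJ, add_mul, sub_mul, mul_add, mul_sub, mul_one, hpE₁, hpE₂, i₁, hE₁₂, hWE, hWE₂,
      hpW, hpV, hE₁W, hEV, hW2, hWW', hr]
    abel
  refine ⟨z₀ + y, ?_, ?_, ⟨?_, ?_⟩, ?_, ?_⟩
  · have h1 : IsCompactOperator (star W : H →L[ℂ] H) := by
      have : star W = star W * W * star W := by rw [hWW, hEV]
      rw [this]
      exact (hWc.mul_left _).mul_right _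
    have h2 : IsCompactOperator (J : H →L[ℂ] H) := hWc.sub h1
    exact hz₀c.add (h2.smul (π / 2))
  · rw [skewAdjoint.mem_iff, star_add, hs₀, hys, neg_add]
  -- Co-diagonality of z₀ is known for r, but r and p differ only by E₁ and E₂, which z₀ annihilates
  -- on both sides.
  · have h1 := hz₀d.1
    have h2 : p * J * p = 0 := by
      simp only [hJ, mul_sub, sub_mul, hpW, hpV, hVp]; simp
    have h3 : r * z₀ * r = p * z₀ * p := by
      have h4 : r * z₀ = p * z₀ := by simp only [hr, add_mul, sub_mul, hE₁z, hE₂z]; simp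
      rw [h4, mul_assoc, mul_assoc]
      congr 1
      simp only [hr, mul_add, mul_sub, hzE₁, hzE₂]; simp
    rw [mul_add, add_mul, ← h3, h1, hy, mul_smul_comm, smul_mul_assoc, h2]
    simp
  · have h1 := hz₀d.2
    have h2 : (1 - p) * J * (1 - p) = 0 := by
      simp only [hJ, mul_sub, sub_mul, one_mul, mul_one, hpW, hpV, hVp, hWp]; simp
    have h3 : (1 - r) * z₀ * (1 - r) = (1 - p) * z₀ * (1 - p) := by
      have h4 : (1 - r) * z₀ = (1 - p) * z₀ := by
        simp only [hr, add_mul, sub_mul, hE₁z, hE₂z]; simp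
      rw [h4, mul_assoc, mul_assoc]
      congr 1
      simp only [hr, mul_add, mul_sub, hzE₁, hzE₂]; simp
    rw [mul_add, add_mul, ← h3, h1, hy, mul_smul_comm, smul_mul_assoc, h2]
    simp
  -- z₀ and y act on orthogonal subspaces and have orthogonal ranges, so the norm of the sum is
  -- bounded by the larger of the two norms.
  · refine ContinuousLinearMap.opNorm_le_bound _ (by positivity) fun ξ => ?_
    have h1 : (z₀ + y) ξ = z₀ (ξ - E ξ) + y (E ξ) := by
      have h2 : z₀ (E ξ) = 0 := congr($hzE ξ)
      have h3 : y (E ξ) = y ξ := congr($hyE ξ)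
      simp [h2, h3]
    have h2 : inner ℂ (z₀ (ξ - E ξ)) (y (E ξ)) = 0 := by
      rw [← ContinuousLinearMap.adjoint_inner_right, ← ContinuousLinearMap.star_eq_adjoint, hs₀]
      have : z₀ (y (E ξ)) = 0 := congr($hzy (E ξ))
      simp [this]
    have h3 : ‖(z₀ + y) ξ‖ ^ 2 = ‖z₀ (ξ - E ξ)‖ ^ 2 + ‖y (E ξ)‖ ^ 2 := by
      rw [h1, @norm_add_sq ℂ, h2]
      simp
    have hyn : ‖y‖ ≤ π / 2 := by
      rw [hy, norm_smul, Real.norm_of_nonneg (by positivity)]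
      exact mul_le_of_le_one_right (by positivity) hJn
    have h4 := z₀.le_of_opNorm_le hz₀n (ξ - E ξ)
    have h5 := y.le_of_opNorm_le hyn (E ξ)
    have h6 := hEE.norm_sq_add_norm_sq ξ
    have h7 := pow_le_pow_left₀ (norm_nonneg _) h4 2
    have h8 := pow_le_pow_left₀ (norm_nonneg _) h5 2
    refine abs_le_of_sq_le_sq' ?_ (by positivity) |>.2
    rw [mul_pow] at h7 h8 ⊢
    rw [h3, ← h6]
    linarith
  · have hcomm : Commute z₀ y := by rw [commute_iff_eq, hzy, hyz]
    have hcomm' : Commute (-y) (-z₀) := by rw [commute_iff_eq, neg_mul_neg, neg_mul_neg, hzy, hyz]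
    rw [NormedSpace.exp_add_of_commute hcomm, neg_add_rev, NormedSpace.exp_add_of_commute hcomm',
      hz₀e, ← hconj]
    simp only [mul_assoc]

end

/-! ### Lower bound for lengths by the angle to a fixed vector -/

section

variable {H : Type*} [NormedAddCommGroup H] [InnerProductSpace ℂ H]

/-- The one-sided derivative is continuous up to the endpoints of a piece, as the angle estimate
needs, whereas length is defined by `deriv`; they can differ only at the endpoints. -/
theorem ofReal_intervalIntegral_norm_derivWithin {σ : ℝ → H →L[ℂ] H} {a b : ℝ} (hab : a < b)
    (hσ : ContDiffOn ℝ 1 σ (Icc a b)) :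
    ENNReal.ofReal (∫ t in a..b, ‖derivWithin σ (Icc a b) t‖) = ∫⁻ t in Ioc a b, ‖deriv σ t‖ₑ := by
  have hvc : ContinuousOn (fun t => ‖derivWithin σ (Icc a b) t‖) (Icc a b) :=
    (hσ.continuousOn_derivWithin (uniqueDiffOn_Icc hab) le_rfl).norm
  rw [intervalIntegral.integral_of_le hab.le, MeasureTheory.ofReal_integral_eq_lintegral_ofReal
    ((hvc.integrableOn_Icc).mono_set Ioc_subset_Icc_self)
    (Filter.Eventually.of_forall fun _ => norm_nonneg _),
    ← MeasureTheory.restrict_Ioo_eq_restrict_Ioc]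
  refine MeasureTheory.setLIntegral_congr_fun measurableSet_Ioo fun t ht => ?_
  simp only [ofReal_norm]
  rw [derivWithin_of_mem_nhds (Icc_mem_nhds ht.1 ht.2)]

variable [CompleteSpace H]

/-- The commutator is (1 - b)yb - by(1 - b): two off-diagonal blocks of y with orthogonal domains
and orthogonal ranges. -/
theorem IsStarProjection.norm_commutator_le {b : H →L[ℂ] H} (hb : IsStarProjection b)
    (y : H →L[ℂ] H) : ‖y * b - b * y‖ ≤ ‖y‖ := by
  refine ContinuousLinearMap.opNorm_le_bound _ (norm_nonneg _) fun ξ => ?_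
  have h1 : (y * b - b * y) ξ = (y (b ξ) - b (y (b ξ))) - b (y (ξ - b ξ)) := by simp
  have h2 : inner ℂ (y (b ξ) - b (y (b ξ))) (b (y (ξ - b ξ))) = 0 := by
    rw [← hb.inner_apply_left, map_sub, hb.apply_apply, sub_self, inner_zero_left]
  have h3 : ‖(y * b - b * y) ξ‖ ^ 2 = ‖y (b ξ) - b (y (b ξ))‖ ^ 2 + ‖b (y (ξ - b ξ))‖ ^ 2 := by
    rw [h1, @norm_sub_sq ℂ, h2]
    simp
  have h4 := hb.norm_sq_add_norm_sq (y (b ξ))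
  have h5 := hb.norm_sq_add_norm_sq (y (ξ - b ξ))
  have h6 := hb.norm_sq_add_norm_sq ξ
  have h7 := pow_le_pow_left₀ (norm_nonneg _) (y.le_opNorm (b ξ)) 2
  have h8 := pow_le_pow_left₀ (norm_nonneg _) (y.le_opNorm (ξ - b ξ)) 2
  refine abs_le_of_sq_le_sq' ?_ (by positivity) |>.2
  rw [mul_pow] at h7 h8 ⊢
  rw [h3, ← h6]
  nlinarith [sq_nonneg ‖b (y (b ξ))‖, sq_nonneg ‖y (ξ - b ξ) - b (y (ξ - b ξ))‖]

theorem IsStarProjection.enorm_le_finslerNorm {b : H →L[ℂ] H} (hb : IsStarProjection b)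
    (x : H →L[ℂ] H) : ‖x‖ₑ ≤ finslerNorm b x := by
  refine le_iInf fun ⟨y, _, _, hy⟩ => ?_
  subst hy
  exact enorm_le_iff_norm_le.2 (hb.norm_commutator_le y)

theorem IsStarProjection.norm_sq_eq_re_inner {p : H →L[ℂ] H} (hp : IsStarProjection p) (ξ : H) :
    ‖p ξ‖ ^ 2 = (inner ℂ ξ (p ξ)).re := by
  rw [hp.inner_self_apply, Complex.ofReal_re]

/-- The velocity `x` of a curve of projections at `p` satisfies `x = x p + p x`. -/
theorem IsStarProjection.abs_re_inner_apply_le {p x : H →L[ℂ] H} (hp : IsStarProjection p)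
    (hx : x = x * p + p * x) (ξ : H) :
    |(inner ℂ ξ (x ξ)).re| ≤ 2 * ‖x‖ * ‖p ξ‖ * ‖ξ - p ξ‖ := by
  -- Compressing x = xp + px to the range of p gives pxp = 2pxp.
  have hpxp (η : H) : p (x (p η)) = 0 := by
    have h := congr(p ($hx (p η)))
    have h' : p ((x * p + p * x) (p η)) = p (x (p η)) + p (x (p η)) := by
      simp [hp.apply_apply]
    rw [h'] at h
    simpa using h
  have h1 : inner ℂ ξ (x (p ξ)) = inner ℂ (ξ - p ξ) (x (p ξ)) := by
    rw [inner_sub_left, hp.inner_apply_left, hpxp, inner_zero_right, sub_zero]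
  have h2 : inner ℂ ξ (p (x ξ)) = inner ℂ (p ξ) (x (ξ - p ξ)) := by
    rw [map_sub, inner_sub_right, hp.inner_apply_left, hp.inner_apply_left, hpxp, inner_zero_right,
      sub_zero]
  have h3 : inner ℂ ξ (x ξ) = inner ℂ (ξ - p ξ) (x (p ξ)) + inner ℂ (p ξ) (x (ξ - p ξ)) := by
    rw [← h1, ← h2, ← inner_add_right]
    exact congr(inner ℂ ξ ($hx ξ))
  refine (Complex.abs_re_le_norm _).trans ?_
  rw [h3]
  refine (norm_add_le _ _).trans ?_
  have h4 := (norm_inner_le_norm (𝕜 := ℂ) (ξ - p ξ) (x (p ξ))).trans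
    (mul_le_mul_of_nonneg_left (x.le_opNorm (p ξ)) (norm_nonneg _))
  have h5 := (norm_inner_le_norm (𝕜 := ℂ) (p ξ) (x (ξ - p ξ))).trans
    (mul_le_mul_of_nonneg_left (x.le_opNorm (ξ - p ξ)) (norm_nonneg _))
  linarith

/-- The angle between a fixed unit vector and the range of a projection varies along a `C¹` curve
of projections by at most the length of the curve in the operator norm. -/
theorem arccos_norm_apply_le {σ : ℝ → H →L[ℂ] H} {a b : ℝ} (hab : a < b)
    (hσ : ContDiffOn ℝ 1 σ (Icc a b)) (hp : ∀ t ∈ Icc a b, IsStarProjection (σ t))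
    {ξ : H} (hξ : ‖ξ‖ = 1) :
    arccos ‖σ b ξ‖ ≤ arccos ‖σ a ξ‖ + ∫ t in a..b, ‖derivWithin σ (Icc a b) t‖ := by
  set v : ℝ → H →L[ℂ] H := derivWithin σ (Icc a b) with hv
  have hvc : ContinuousOn v (Icc a b) :=
    hσ.continuousOn_derivWithin (uniqueDiffOn_Icc hab) le_rfl
  have hlc : ContinuousOn (fun t => ‖v t‖) (Icc a b) := hvc.norm
  have hder (t : ℝ) (ht : t ∈ Icc a b) : HasDerivWithinAt σ (v t) (Icc a b) t :=
    ((hσ.differentiableOn one_ne_zero) t ht).hasDerivWithinAt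
  have hle1 (t : ℝ) (ht : t ∈ Icc a b) : ‖σ t ξ‖ ≤ 1 := by
    have := (hp t ht).norm_sq_add_norm_sq ξ
    rw [hξ] at this
    nlinarith [sq_nonneg ‖ξ - σ t ξ‖, norm_nonneg (σ t ξ)]
  have hcos (t : ℝ) (ht : t ∈ Icc a b) : cos (arccos ‖σ t ξ‖) = ‖σ t ξ‖ :=
    cos_arccos (by linarith [norm_nonneg (σ t ξ)]) (hle1 t ht)
  have hvel (t : ℝ) (ht : t ∈ Icc a b) : v t = v t * σ t + σ t * v t := by
    have h1 : HasDerivWithinAt (fun s => σ s * σ s) (v t * σ t + σ t * v t) (Icc a b) t :=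
      (hder t ht).mul (hder t ht)
    have h2 : HasDerivWithinAt (fun s => σ s * σ s) (v t) (Icc a b) t :=
      (hder t ht).congr (fun s hs => (hp s hs).isIdempotentElem.eq)
        (hp t ht).isIdempotentElem.eq
    exact (uniqueDiffOn_Icc hab t ht).eq_deriv _ h2 h1
  have hu (t : ℝ) (ht : t ∈ Icc a b) :
      HasDerivWithinAt (fun s => ‖σ s ξ‖ ^ 2) (inner ℂ ξ (v t ξ)).re (Icc a b) t := by
    let Φ : (H →L[ℂ] H) →L[ℝ] ℝ :=
      Complex.reCLM ∘L ((innerSL ℂ ξ ∘L ContinuousLinearMap.apply ℂ H ξ).restrictScalars ℝ)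
    have h1 : HasDerivWithinAt (fun s => Φ (σ s)) (Φ (v t)) (Icc a b) t :=
      Φ.hasFDerivAt.comp_hasDerivWithinAt t (hder t ht)
    exact h1.congr (fun s hs => (hp s hs).norm_sq_eq_re_inner ξ) ((hp t ht).norm_sq_eq_re_inner ξ)
  have hmem (t : ℝ) (ht : t ∈ Ico a b) : Icc a b ∈ nhdsWithin t (Ici t) :=
    Icc_mem_nhdsGE_of_mem ht
  have hii : IntervalIntegrable (fun t => ‖v t‖) MeasureTheory.volume a b :=
    (hlc.mono (by rw [uIcc_of_le hab.le])).intervalIntegrable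
  by_contra! hlt
  set Λ : ℝ → ℝ := fun t => ∫ s in a..t, ‖v s‖ with hΛ
  have hΛc : ContinuousOn Λ (Icc a b) := by
    have := intervalIntegral.continuousOn_primitive_interval' hii left_mem_uIcc
    rwa [uIcc_of_le hab.le] at this
  have hΛd (t : ℝ) (ht : t ∈ Ico a b) : HasDerivWithinAt Λ ‖v t‖ (Ici t) t := by
    have hsub : Ico a b ⊆ Icc a b := Ico_subset_Icc_self
    have h1 : ContinuousWithinAt (fun t => ‖v t‖) (Ioi t) t :=
      ((hlc t (hsub ht)).mono_of_mem_nhdsWithin (hmem t ht)).mono Ioi_subset_Ici_self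
    refine intervalIntegral.integral_hasDerivWithinAt_right
      (hii.mono_set ?_) ?_ h1
    · rw [uIcc_of_le hab.le, uIcc_of_le ht.1]
      exact Icc_subset_Icc_right ht.2.le
    · refine ⟨Icc a b, nhdsWithin_mono t Ioi_subset_Ici_self (hmem t ht), ?_⟩
      exact hlc.aestronglyMeasurable measurableSet_Icc
  have hΛ0 : Λ a = 0 := intervalIntegral.integral_same
  have hΛnn (t : ℝ) (ht : t ∈ Icc a b) : 0 ≤ Λ t :=
    intervalIntegral.integral_nonneg ht.1 fun _ _ => norm_nonneg _
  have hΛmono (t : ℝ) (ht : t ∈ Icc a b) : Λ t ≤ Λ b :=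
    intervalIntegral.integral_mono_interval le_rfl ht.1 ht.2
      (Filter.Eventually.of_forall fun _ => norm_nonneg _) hii
  set θ := arccos ‖σ a ξ‖ with hθ
  have hθ0 : 0 ≤ θ := arccos_nonneg _
  have hbpi : arccos ‖σ b ξ‖ ≤ π / 2 := arccos_le_pi_div_two.2 (norm_nonneg _)
  -- The slope ε makes the differential inequality below strict, and the 1 in 1 + (t - a) keeps φ
  -- positive at t = a. Thus φ stays in (0, π/2), where sine and cosine are positive.
  obtain ⟨ε, hε, hεlt⟩ : ∃ ε > 0, θ + Λ b + ε * (1 + (b - a)) < arccos ‖σ b ξ‖ := by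
    have hb : 0 < 1 + (b - a) := by linarith
    refine ⟨(arccos ‖σ b ξ‖ - (θ + Λ b)) / (2 * (1 + (b - a))), ?_, ?_⟩
    · exact div_pos (by linarith) (by linarith)
    · have : (arccos ‖σ b ξ‖ - (θ + Λ b)) / (2 * (1 + (b - a))) * (1 + (b - a)) =
        (arccos ‖σ b ξ‖ - (θ + Λ b)) / 2 := by field_simp
      rw [this]
      linarith
  set φ : ℝ → ℝ := fun t => θ + Λ t + ε * (1 + (t - a)) with hφ
  have hφpos (t : ℝ) (ht : t ∈ Icc a b) : 0 < φ t := by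
    have := hΛnn t ht
    have : 0 < ε * (1 + (t - a)) := mul_pos hε (by linarith [ht.1])
    simp only [hφ]
    linarith
  have hφlt (t : ℝ) (ht : t ∈ Icc a b) : φ t < arccos ‖σ b ξ‖ := by
    refine lt_of_le_of_lt ?_ hεlt
    simp only [hφ]
    gcongr
    · exact hΛmono t ht
    · exact ht.2
  have hφd (t : ℝ) (ht : t ∈ Ico a b) : HasDerivWithinAt φ (‖v t‖ + ε) (Ici t) t := by
    have h1 : HasDerivWithinAt (fun t : ℝ => ε * (1 + (t - a))) ε (Ici t) t := by
      simpa using (((hasDerivAt_id t).sub_const a).const_add 1).const_mul ε |>.hasDerivWithinAt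
    exact ((hΛd t ht).const_add θ).add h1
  have hφc : ContinuousOn φ (Icc a b) := (continuousOn_const.add hΛc).add (by fun_prop)
  -- The squares are compared because arccos is not differentiable at 1 nor the norm at 0. Where
  -- ‖σ(t)ξ‖ = cos φ, also ‖ξ - σ(t)ξ‖ = sin φ, so the derivative is at most 2‖v‖ cos φ sin φ, less
  -- than that of the barrier.
  have key := image_le_of_deriv_right_lt_deriv_boundary' (a := a) (b := b)
    (f := fun t => -‖σ t ξ‖ ^ 2) (f' := fun t => -(inner ℂ ξ (v t ξ)).re)
    (B := fun t => -cos (φ t) ^ 2)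
    (B' := fun t => -(2 * cos (φ t) * (-sin (φ t) * (‖v t‖ + ε))))
    (fun t ht => (hu t ht).continuousWithinAt.neg)
    (fun t ht => ((hu t (Ico_subset_Icc_self ht)).mono_of_mem_nhdsWithin (hmem t ht)).neg)
    (by
      have ha : a ∈ Icc a b := left_mem_Icc.2 hab.le
      have h1 : cos (φ a) ≤ ‖σ a ξ‖ := by
        rw [← hcos a ha]
        refine cos_le_cos_of_nonneg_of_le_pi hθ0 (by linarith [hφlt a ha, pi_pos]) ?_
        simp only [hφ, hΛ0]
        linarith
      have h2 : 0 ≤ cos (φ a) :=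
        cos_nonneg_of_neg_pi_div_two_le_of_le (by linarith [hφpos a ha, pi_pos])
          (by linarith [hφlt a ha])
      nlinarith)
    ((continuous_cos.comp_continuousOn hφc).pow 2).neg
    (fun t ht => ((hφd t ht).cos.pow 2).neg.congr_deriv (by simp))
    (fun t ht heq => by
      have ht' := Ico_subset_Icc_self ht
      have hc : 0 < cos (φ t) :=
        cos_pos_of_mem_Ioo ⟨by linarith [hφpos t ht', pi_pos], by linarith [hφlt t ht']⟩
      have hs : 0 < sin (φ t) :=
        sin_pos_of_pos_of_lt_pi (hφpos t ht') (by linarith [hφlt t ht', pi_pos])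
      have h1 : ‖σ t ξ‖ = cos (φ t) := by
        have : ‖σ t ξ‖ ^ 2 = cos (φ t) ^ 2 := by linarith
        exact (sq_eq_sq₀ (norm_nonneg _) hc.le).1 this
      have h2 : ‖ξ - σ t ξ‖ = sin (φ t) := by
        have h3 := (hp t ht').norm_sq_add_norm_sq ξ
        have : ‖ξ - σ t ξ‖ ^ 2 = sin (φ t) ^ 2 := by
          rw [hξ, h1] at h3
          linarith [sin_sq_add_cos_sq (φ t)]
        exact (sq_eq_sq₀ (norm_nonneg _) hs.le).1 this
      have h3 := (hp t ht').abs_re_inner_apply_le (hvel t ht') ξ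
      rw [h1, h2] at h3
      have h4 := neg_le_of_abs_le h3
      have h5 : 0 < cos (φ t) * sin (φ t) * ε := by positivity
      nlinarith)
  have hb : b ∈ Icc a b := right_mem_Icc.2 hab.le
  have h1 := key hb
  have h2 : ‖σ b ξ‖ < cos (φ b) := by
    rw [← hcos b hb]
    exact cos_lt_cos_of_nonneg_of_le_pi (hφpos b hb).le (arccos_le_pi _) (hφlt b hb)
  change -‖σ b ξ‖ ^ 2 ≤ -cos (φ b) ^ 2 at h1
  nlinarith [norm_nonneg (σ b ξ)]

theorem ofReal_arccos_norm_apply_le {σ : ℝ → H →L[ℂ] H} {a b : ℝ}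
    (hσ : IsPiecewiseC1 a b σ) (hp : ∀ t ∈ Icc a b, IsStarProjection (σ t))
    {ξ : H} (hξ : ‖ξ‖ = 1) :
    ENNReal.ofReal (arccos ‖σ b ξ‖) ≤
      ENNReal.ofReal (arccos ‖σ a ξ‖) + ∫⁻ t in Ioc a b, ‖deriv σ t‖ₑ := by
  obtain ⟨n, s, hs, rfl, rfl, hd⟩ := hσ
  suffices h : ∀ k : Fin (n + 1), ENNReal.ofReal (arccos ‖σ (s k) ξ‖) ≤
      ENNReal.ofReal (arccos ‖σ (s 0) ξ‖) + ∫⁻ t in Ioc (s 0) (s k), ‖deriv σ t‖ₑ from h _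
  intro k
  induction k using Fin.induction with
  | zero => simp
  | succ i ih =>
    have h0 : s 0 ≤ s i.castSucc := hs.monotone (Fin.zero_le _)
    have h1 : s i.castSucc < s i.succ := hs i.castSucc_lt_succ
    have h2 : s i.succ ≤ s (Fin.last n) := hs.monotone (Fin.le_last _)
    have h3 := arccos_norm_apply_le h1 (hd i)
      (fun t ht => hp t ⟨h0.trans ht.1, ht.2.trans h2⟩) hξ
    have h4 : 0 ≤ ∫ t in s i.castSucc..s i.succ,
        ‖derivWithin σ (Icc (s i.castSucc) (s i.succ)) t‖ :=
      intervalIntegral.integral_nonneg h1.le fun _ _ => norm_nonneg _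
    refine (ENNReal.ofReal_le_ofReal h3).trans ?_
    rw [ENNReal.ofReal_add (arccos_nonneg _) h4,
      ofReal_intervalIntegral_norm_derivWithin h1 (hd i)]
    refine (add_le_add_left ih _).trans ?_
    rw [add_assoc, ← Ioc_union_Ioc_eq_Ioc h0 h1.le,
      MeasureTheory.lintegral_union measurableSet_Ioc (Ioc_disjoint_Ioc_of_le le_rfl)]

/-- A lower bound for the length of curves in the orbit of a projection. -/
theorem IsOrbitCurve.ofReal_arccos_le_finslerLength {P : H →L[ℂ] H} (hP : IsStarProjection P)
    {a b : ℝ} {σ : ℝ → H →L[ℂ] H} {p q : H →L[ℂ] H} (hσ : IsOrbitCurve P a b σ p q)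
    {ξ : H} (hξ : ‖ξ‖ = 1) (hpξ : p ξ = ξ) :
    ENNReal.ofReal (arccos ‖q ξ‖) ≤ finslerLength a b σ := by
  have hproj (t : ℝ) (ht : t ∈ Icc a b) : IsStarProjection (σ t) :=
    isStarProjection_of_mem_fredholmOrbit hP (hσ.mem_orbit t ht)
  have h := ofReal_arccos_norm_apply_le hσ.piecewiseC1 hproj hξ
  rw [hσ.source, hσ.target, hpξ, hξ, arccos_one, ENNReal.ofReal_zero, zero_add] at h
  refine h.trans ((MeasureTheory.lintegral_mono_set Ioc_subset_Icc_self).trans ?_)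
  exact MeasureTheory.setLIntegral_mono' measurableSet_Icc fun t ht =>
    (hproj t ht).enorm_le_finslerNorm _

end

/-! ### The geodesic: its length, its final angle and its velocity -/

section

variable {H : Type*} [NormedAddCommGroup H] [InnerProductSpace ℂ H]

theorem IsCodiagonal.mul_add_mul {p z : H →L[ℂ] H} (h : IsCodiagonal p z) :
    p * z + z * p = z := by
  have h1 : z - (p * z + z * p) = (1 - p) * z * (1 - p) - p * z * p := by noncomm_ring
  rw [h.1, h.2, sub_zero, sub_eq_zero] at h1
  exact h1.symm

theorem ContDiff.isPiecewiseC1 {γ : ℝ → H →L[ℂ] H} (hγ : ContDiff ℝ 1 γ) {a b : ℝ} (hab : a < b) :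
    IsPiecewiseC1 a b γ := by
  refine ⟨1, ![a, b], ?_, rfl, rfl, fun i => hγ.contDiffOn⟩
  rw [Fin.strictMono_iff_lt_succ]
  intro i
  fin_cases i
  simpa using hab

variable [CompleteSpace H]

/-- A compact anti-hermitian operator which is co-diagonal with respect to `p` attains its norm
on an eigenvector of its square in the range of `p`. -/
theorem exists_apply_apply_eq_neg_norm_sq_smul {p z : H →L[ℂ] H} (hp : IsStarProjection p)
    (hz : IsCompactOperator z) (hs : z ∈ skewAdjoint (H →L[ℂ] H)) (hd : IsCodiagonal p z)
    (h0 : z ≠ 0) : ∃ ξ : H, ‖ξ‖ = 1 ∧ p ξ = ξ ∧ z (z ξ) = -(‖z‖ ^ 2) • ξ := by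
  have : Nontrivial (H →L[ℂ] H) := ⟨z, 0, h0⟩
  have hn : ‖z‖ ≠ 0 := norm_ne_zero_iff.2 h0
  suffices h : ∃ η : H, η ≠ 0 ∧ p η = η ∧ z (z η) = -(‖z‖ ^ 2) • η by
    obtain ⟨η, hη, h1, h2⟩ := h
    have hr (A : H →L[ℂ] H) (r : ℝ) (x : H) : A (r • x) = r • A x := A.map_smul_of_tower r x
    refine ⟨‖η‖⁻¹ • η, ?_, by rw [hr, h1], by rw [hr, hr, h2, smul_comm]⟩
    rw [norm_smul, norm_inv, norm_norm, inv_mul_cancel₀ (norm_ne_zero_iff.2 hη)]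
  have hpz (x : H) : p (z x) = z x - z (p x) := by
    rw [eq_sub_iff_add_eq]
    exact congr($(hd.mul_add_mul) x)
  have hnorm : ‖star z * z‖ = ‖z‖ ^ 2 := by rw [CStarRing.norm_star_mul_self, pow_two]
  have hspec := CStarAlgebra.norm_mem_spectrum_of_nonneg (star_mul_self_nonneg z)
  rw [hnorm, ← spectrum.algebraMap_mem_iff ℂ] at hspec
  have hne : algebraMap ℝ ℂ (‖z‖ ^ 2) ≠ 0 := by simpa using hn
  obtain ⟨ξ, hξ⟩ := (((hz.mul_left (star z)).hasEigenvalue_iff_mem_spectrum hne).2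
    hspec).exists_hasEigenvector
  have hzz : z (z ξ) = -(‖z‖ ^ 2) • ξ := by
    have h1 := hξ.apply_eq_smul
    rw [skewAdjoint.mem_iff.1 hs] at h1
    have h2 : -z (z ξ) = (‖z‖ ^ 2) • ξ := h1
    rw [neg_smul, ← h2, neg_neg]
  -- z² commutes with p, so pξ is again an eigenvector unless it is zero; in that case zξ is one, as
  -- z maps the kernel of p into its range.
  by_cases hpξ : p ξ = 0
  · refine ⟨z ξ, fun h => ?_, by rw [hpz, hpξ, map_zero, sub_zero], ?_⟩
    · rw [h, map_zero, eq_comm, smul_eq_zero] at hzz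
      exact hzz.elim (fun h => hn (by simpa using h)) hξ.2
    · rw [hzz]
      exact z.map_smul_of_tower _ _
  · refine ⟨p ξ, hpξ, hp.apply_apply ξ, ?_⟩
    have h1 : z (z (p ξ)) = p (z (z ξ)) := by rw [hpz, hpz, map_sub]; abel
    rw [h1, hzz]
    exact p.map_smul_of_tower _ _

/-- e^{-z} rotates ξ by the angle ω towards zξ, which lies in the kernel of p; hence p leaves cos ω
· ξ, and e^z is isometric. -/
theorem norm_exp_mul_mul_exp_neg_apply {p z : H →L[ℂ] H}
    (hs : z ∈ skewAdjoint (H →L[ℂ] H)) (hd : IsCodiagonal p z) {ξ : H} {ω : ℝ} (hω : ω ≠ 0)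
    (hξ : ‖ξ‖ = 1) (hpξ : p ξ = ξ) (hzξ : z (z ξ) = -(ω ^ 2) • ξ) :
    ‖(NormedSpace.exp z * p * NormedSpace.exp (-z)) ξ‖ = |cos ω| := by
  let _ : NormedAlgebra ℚ (H →L[ℂ] H) := NormedAlgebra.restrictScalars ℚ ℝ _
  have hu : NormedSpace.exp z ∈ unitary (H →L[ℂ] H) :=
    NormedSpace.exp_mem_unitary_of_mem_skewAdjoint hs
  have h1 : NormedSpace.exp (-z) ξ = cos ω • ξ + (sin ω / ω) • (-z) ξ :=
    exp_apply_of_apply_apply_eq hω (by simpa using hzξ)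
  have hr (r : ℝ) (x : H) : p (r • x) = r • p x := p.map_smul_of_tower r x
  have h2 : p (z ξ) = 0 := by
    have := congr($(hd.1) ξ)
    simpa [hpξ] using this
  have h3 : p (NormedSpace.exp (-z) ξ) = cos ω • ξ := by
    rw [h1, map_add, hr, hr, hpξ, neg_apply, map_neg, h2]
    simp
  change ‖NormedSpace.exp z (p (NormedSpace.exp (-z) ξ))‖ = _
  rw [h3, ContinuousLinearMap.norm_map_of_mem_unitary hu, norm_smul, hξ, mul_one, Real.norm_eq_abs]

theorem hasDerivAt_orbitGeodesic (p z : H →L[ℂ] H) (t : ℝ) :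
    HasDerivAt (orbitGeodesic p z) (z * orbitGeodesic p z t - orbitGeodesic p z t * z) t := by
  have h1 : HasDerivAt (fun s : ℝ => NormedSpace.exp (s • z)) (z * NormedSpace.exp (t • z)) t :=
    hasDerivAt_exp_smul_const' z t
  have h := (h1.mul_const p).mul (hasDerivAt_exp_neg_smul z t)
  refine h.congr_deriv ?_
  simp only [orbitGeodesic]
  noncomm_ring

theorem contDiff_orbitGeodesic (p z : H →L[ℂ] H) : ContDiff ℝ 1 (orbitGeodesic p z) := by
  rw [contDiff_one_iff_deriv]
  have hd : Differentiable ℝ (orbitGeodesic p z) :=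
    fun t => (hasDerivAt_orbitGeodesic p z t).differentiableAt
  refine ⟨hd, ?_⟩
  rw [funext fun t => (hasDerivAt_orbitGeodesic p z t).deriv]
  have := hd.continuous
  fun_prop

theorem isOrbitCurve_orbitGeodesic {P p z : H →L[ℂ] H} (hp : p ∈ fredholmOrbit P)
    (hz : IsCompactOperator z) (hs : z ∈ skewAdjoint (H →L[ℂ] H)) :
    IsOrbitCurve P 0 1 (orbitGeodesic p z) p
      (NormedSpace.exp z * p * NormedSpace.exp (-z)) where
  lt := zero_lt_one
  source := by simp [orbitGeodesic]
  target := by simp [orbitGeodesic]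
  mem_orbit t _ := by
    have hst : t • z ∈ skewAdjoint (H →L[ℂ] H) := by
      rw [skewAdjoint.mem_iff, star_smul, skewAdjoint.mem_iff.1 hs]
      simp
    rw [orbitGeodesic, ← star_exp_of_mem_skewAdjoint hst]
    exact mul_mul_star_mem_fredholmOrbit hp (exp_mem_fredholmUnitary (hz.smul t) hst)
  piecewiseC1 := (contDiff_orbitGeodesic p z).isPiecewiseC1 zero_lt_one

/-- The velocity at γ(t) is zγ(t) - γ(t)z, so the same z is a lifting at every time. -/
theorem finslerLength_orbitGeodesic_le {p z : H →L[ℂ] H}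
    (hz : IsCompactOperator z) (hs : z ∈ skewAdjoint (H →L[ℂ] H)) :
    finslerLength 0 1 (orbitGeodesic p z) ≤ ‖z‖ₑ := by
  have h (t : ℝ) : finslerNorm (orbitGeodesic p z t) (deriv (orbitGeodesic p z) t) ≤ ‖z‖ₑ :=
    iInf_le_of_le ⟨z, hz, hs, (hasDerivAt_orbitGeodesic p z t).deriv.symm⟩ le_rfl
  refine (MeasureTheory.lintegral_mono h).trans ?_
  simp

/-- If the velocity vanishes once, z commutes with that point of the curve, hence with p, because
e^{tz} commutes with z; then e^z p e^{-z} = p. -/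
theorem deriv_orbitGeodesic_ne_zero {p z : H →L[ℂ] H}
    (h : p ≠ NormedSpace.exp z * p * NormedSpace.exp (-z)) (t : ℝ) :
    deriv (orbitGeodesic p z) t ≠ 0 := by
  intro h0
  rw [(hasDerivAt_orbitGeodesic p z t).deriv, sub_eq_zero] at h0
  have hc : Commute (NormedSpace.exp (t • z)) z :=
    ((Commute.refl z).smul_left t).exp_left
  have hc' : Commute (NormedSpace.exp (-(t • z))) z :=
    ((Commute.refl z).smul_left t).neg_left.exp_left
  have h1 : p = NormedSpace.exp (-(t • z)) * orbitGeodesic p z t * NormedSpace.exp (t • z) := by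
    have := exp_neg_mul_exp (t • z)
    calc p = 1 * p * 1 := by simp
      _ = _ := by rw [← this, orbitGeodesic]; simp only [mul_assoc]
  have h2 : Commute z p := by
    rw [h1]
    exact (hc'.symm.mul_right h0).mul_right hc.symm
  refine h ?_
  rw [h2.exp_left.eq, mul_assoc, exp_mul_exp_neg, mul_one]

end

theorem theorem6p1 {H : Type*} [NormedAddCommGroup H] [InnerProductSpace ℂ H] [CompleteSpace H]
    (P : H →L[ℂ] H) (hP : IsStarProjection P)
    (p₀ p₁ : H →L[ℂ] H) (h₀ : p₀ ∈ fredholmOrbit P) (h₁ : p₁ ∈ fredholmOrbit P) :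
    ∃ z : H →L[ℂ] H,
      IsCompactOperator z ∧ z ∈ skewAdjoint (H →L[ℂ] H) ∧ IsCodiagonal p₀ z ∧ ‖z‖ ≤ π / 2 ∧
      p₁ = NormedSpace.exp z * p₀ * NormedSpace.exp (-z) ∧
      IsMinimalCurve P 0 1 (orbitGeodesic p₀ z) p₀ p₁ ∧
      (p₀ ≠ p₁ → ∀ t ∈ Icc (0 : ℝ) 1, deriv (orbitGeodesic p₀ z) t ≠ 0) := by
  have hp₀ := isStarProjection_of_mem_fredholmOrbit hP h₀
  obtain ⟨w, hw, hq⟩ := exists_conj_of_mem_fredholmOrbit h₀ h₁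
  obtain ⟨z, hz, hs, hd, hn, he⟩ := exists_codiagonal_exponent hp₀ hw hq
  have hle := finslerLength_orbitGeodesic_le (p := p₀) hz hs
  refine ⟨z, hz, hs, hd, hn, he, ⟨?_, hle.trans_lt enorm_lt_top, fun c d σ hσ => hle.trans ?_⟩,
    fun hne t _ => deriv_orbitGeodesic_ne_zero (fun h => hne (h.trans he.symm)) t⟩
  · rw [he]
    exact isOrbitCurve_orbitGeodesic h₀ hz hs
  · rcases eq_or_ne z 0 with rfl | hz0
    · simp
    obtain ⟨ξ, hξ, hpξ, hzξ⟩ := exists_apply_apply_eq_neg_norm_sq_smul hp₀ hz hs hd hz0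
    have h1 := hσ.ofReal_arccos_le_finslerLength hP hξ hpξ
    -- The bound ‖z‖ ≤ π/2 enters here: it gives arccos |cos ‖z‖| = ‖z‖.
    have h2 : 0 ≤ cos ‖z‖ :=
      cos_nonneg_of_neg_pi_div_two_le_of_le (by linarith [norm_nonneg z, pi_pos]) hn
    rw [he, norm_exp_mul_mul_exp_neg_apply hs hd (norm_ne_zero_iff.2 hz0) hξ hpξ hzξ,
      abs_of_nonneg h2, arccos_cos (norm_nonneg z) (by linarith [pi_pos]), ofReal_norm] at h1
    exact h1
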